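/- Let $n\ge 3$ and $m\ge 1$ be integers. Let $\mathcal S_n$ be the Sunlet graph on $2n$ vertices, obtained from the $n$-cycle $C_n$ by attaching one pendant edge at each vertex of the cycle, and let $K_{1,m}$ be the star with $m$ leaves. A drawing of a graph places its vertices at distinct points of the plane and represents each edge by a simple arc joining the points of its two endpoints and passing through no other vertex. Its number of crossings is the number of points, other than endpoints, that two distinct edges have in common, counted once for every pair of edges through the point. The crossing number $\operatorname{cr}(G)$ is the smallest number of crossings over all drawings of $G$. Then the cartesian product $\mathcal S_n\,\Box\,K_{1,m}$ satisfies $$\operatorname{cr}\bigl(\mathcal S_n\,\Box\,K_{1,m}\bigr)\le n\,\frac{m(m-1)}{2}.$$ -/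

import Mathlib

/-- The sunlet graph on `2n` vertices: the cycle `C_n` on the vertices `Sum.inl i`, with one
pendant vertex `Sum.inr i` attached to each cycle vertex `Sum.inl i`. -/
def sunletGraph (n : ℕ) : SimpleGraph (Fin n ⊕ Fin n) where
  Adj
    | Sum.inl i, Sum.inl j => (SimpleGraph.cycleGraph n).Adj i j
    | Sum.inl i, Sum.inr j => i = j
    | Sum.inr i, Sum.inl j => i = j
    | Sum.inr _, Sum.inr _ => False
  symm := ⟨by
    rintro (i | i) (j | j) h
    · exact SimpleGraph.Adj.symm h
    · exact Eq.symm h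
    · exact Eq.symm h
    · exact h⟩
  loopless := ⟨by
    rintro (i | i) h
    · exact (SimpleGraph.cycleGraph n).irrefl h
    · exact h⟩

/-- The star `K_{1,m}`, as a complete bipartite graph. -/
abbrev starK (m : ℕ) : SimpleGraph (Fin 1 ⊕ Fin m) :=
  completeBipartiteGraph (Fin 1) (Fin m)

/-- A drawing of a graph in the plane: distinct vertices are placed at distinct points, each edge
is a simple arc between the points of its two endpoints, and no arc passes through the
point of a vertex except at its two ends. -/
structure PlaneDrawing {V : Type*} (G : SimpleGraph V) where
  /-- the points at which the vertices are placed -/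
  pos : V → ℝ × ℝ
  /-- the parametrised arcs representing the edges -/
  arc : G.edgeSet → unitInterval → ℝ × ℝ
  pos_injective : Function.Injective pos
  arc_continuous : ∀ e, Continuous (arc e)
  arc_injective : ∀ e, Function.Injective (arc e)
  arc_ends : ∀ e, s(arc e 0, arc e 1) = Sym2.map pos e.1
  arc_avoids : ∀ e, ∀ t ∈ Set.Ioo (0 : unitInterval) 1, ∀ v, arc e t ≠ pos v

namespace PlaneDrawing

variable {V : Type*} {G : SimpleGraph V}

/-- The points of the arc of the edge `e`, without its two ends. -/
def openArc (D : PlaneDrawing G) (e : G.edgeSet) : Set (ℝ × ℝ) :=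
  D.arc e '' Set.Ioo 0 1

/-- The crossings of a drawing: unordered pairs of distinct edges together with a common point of
their open arcs. If several edges pass through one point, each pair of them is counted; a point
where two arcs only touch is counted as well. -/
def crossingSet (D : PlaneDrawing G) : Set (Sym2 G.edgeSet × (ℝ × ℝ)) :=
  {x | ∃ e f : G.edgeSet, e ≠ f ∧ x.1 = s(e, f) ∧ x.2 ∈ D.openArc e ∩ D.openArc f}

/-- The number of crossings of a drawing (`⊤` if there are infinitely many). -/
noncomputable def crossings (D : PlaneDrawing G) : ℕ∞ :=
  D.crossingSet.encard

end PlaneDrawing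

/-- The crossing number of a graph: the least number of crossings over all its drawings. -/
noncomputable def crossingNumber {V : Type*} (G : SimpleGraph V) : ℕ∞ :=
  ⨅ D : PlaneDrawing G, D.crossings

/-! Roll the plane up to a cylinder of circumference `n` (angle, log-radius). Draw the cycle of copy
`a` as a circle at height `(-2) ^ a`, so leaf copies alternate above and below; the central cycle is
at height 1 and the central pendant vertices are at height 0. All other edges are straight and stay
in narrow columns, one for each `i`, where they do not meet each other (`Edge.eq_of_column`). So
every crossing involves exactly one cycle edge. In a column, copy `j = k + 1` sends one edge to
height 1 and a path to height 0. Each meets only circles of levels `a < j` with the parity of `j`,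
the first avoiding `a = 0`. For either parity of `j` these total `j - 1 = k` crossings. Summing over
`k < m` and over the `n` columns gives the bound; formally, the crossings inject into `Cell n m`. -/

namespace SunletStar

/-! ### Cylinder coordinates -/

/-- The covering of the punctured plane by the plane, with period `n` in the first coordinate. -/
noncomputable def cyl (n : ℕ) (p : ℝ × ℝ) : ℝ × ℝ :=
  (Real.exp p.2 * Real.cos (2 * Real.pi * p.1 / n), Real.exp p.2 * Real.sin (2 * Real.pi * p.1 / n))

lemma continuous_cyl (n : ℕ) : Continuous (cyl n) := by
  unfold cyl; fun_prop

lemma cyl_eq_iff {n : ℕ} (hn : n ≠ 0) {p q : ℝ × ℝ} :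
    cyl n p = cyl n q ↔ p.2 = q.2 ∧ ∃ k : ℤ, p.1 = q.1 + k * n := by
  have hn' : (n : ℝ) ≠ 0 := by exact_mod_cast hn
  have hpi := Real.pi_ne_zero
  constructor
  · intro h
    have h1 := congrArg Prod.fst h
    have h2 := congrArg Prod.snd h
    simp only [cyl] at h1 h2
    -- Summing the squares of both coordinates leaves the squared radius.
    have hy : p.2 = q.2 := by
      have : Real.exp p.2 ^ 2 = Real.exp q.2 ^ 2 := by
        linear_combination (Real.exp p.2 * Real.cos (2 * Real.pi * p.1 / n)
          + Real.exp q.2 * Real.cos (2 * Real.pi * q.1 / n)) * h1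
          + (Real.exp p.2 * Real.sin (2 * Real.pi * p.1 / n)
          + Real.exp q.2 * Real.sin (2 * Real.pi * q.1 / n)) * h2
          - Real.exp p.2 ^ 2 * Real.sin_sq_add_cos_sq (2 * Real.pi * p.1 / n)
          + Real.exp q.2 ^ 2 * Real.sin_sq_add_cos_sq (2 * Real.pi * q.1 / n)
      exact Real.exp_injective
        ((sq_eq_sq₀ (Real.exp_pos _).le (Real.exp_pos _).le).1 this)
    refine ⟨hy, ?_⟩
    rw [hy] at h1 h2
    have hc := mul_left_cancel₀ (Real.exp_ne_zero _) h1
    have hs := mul_left_cancel₀ (Real.exp_ne_zero _) h2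
    have ha := Real.Angle.cos_sin_inj hc hs
    obtain ⟨k, hk⟩ := Real.Angle.angle_eq_iff_two_pi_dvd_sub.1 ha
    refine ⟨k, ?_⟩
    field_simp at hk
    linarith
  · rintro ⟨hy, k, hk⟩
    have : 2 * Real.pi * p.1 / n = 2 * Real.pi * q.1 / n + k * (2 * Real.pi) := by
      rw [hk]; field_simp
    simp only [cyl, hy, this, Real.cos_add_int_mul_two_pi, Real.sin_add_int_mul_two_pi]

/-- The integer `i - j - k * n` lies strictly between -1 and 1, hence vanishes, and `|i - j| < n`
forces `k = 0`. Thus points of narrow columns can be compared as if in the plane. -/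
lemma column_unique {n : ℕ} {i j : Fin n} {u v : ℝ} {k : ℤ}
    (h : (i : ℝ) + u = j + v + k * n) (h1 : u - v < 1) (h2 : v - u < 1) : i = j ∧ u = v := by
  have a1 : ((i : ℤ) - j - k * n : ℤ) < 1 := by
    have : (((i : ℤ) - j - k * n : ℤ) : ℝ) < 1 := by push_cast; linarith
    exact_mod_cast this
  have a2 : -1 < ((i : ℤ) - j - k * n : ℤ) := by
    have : -1 < (((i : ℤ) - j - k * n : ℤ) : ℝ) := by push_cast; linarith
    exact_mod_cast this
  have a3 : (i : ℤ) - j = k * n := by omega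
  have hi := i.2
  have hj := j.2
  have hk : k = 0 := by
    by_contra hk
    rcases lt_or_gt_of_ne hk with hk | hk
    · have : k * (n : ℤ) ≤ -1 * n := mul_le_mul_of_nonneg_right (by omega) (by omega)
      omega
    · have : 1 * (n : ℤ) ≤ k * n := mul_le_mul_of_nonneg_right (by omega) (by omega)
      omega
  subst hk
  have hij : i = j := Fin.ext (by omega)
  subst hij
  exact ⟨rfl, by simpa using h⟩

/-! ### Heights of the cycles -/

/-- Number of a copy of the sunlet graph: `0` for the copy at the centre of the star. -/
def level {m : ℕ} : Fin 1 ⊕ Fin m → ℕ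
  | Sum.inl _ => 0
  | Sum.inr k => k + 1

lemma level_injective {m : ℕ} : Function.Injective (level (m := m)) := by
  rintro (a | a) (b | b) h
  · rw [Subsingleton.elim a b]
  · simp [level] at h
  · simp [level] at h
  · simp only [level] at h
    rw [Fin.ext (by omega : (a : ℕ) = b)]

/-- Height of the cycle in a copy of the sunlet graph. -/
noncomputable def height {m : ℕ} (s : Fin 1 ⊕ Fin m) : ℝ := (-2) ^ level s

/-- Horizontal displacement of the vertices of that cycle. -/
noncomputable def offset {m : ℕ} : Fin 1 ⊕ Fin m → ℝ
  | Sum.inl _ => -1 / 4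
  | Sum.inr _ => 0

lemma neg_two_pow_even {a : ℕ} (h : a % 2 = 0) : (-2 : ℝ) ^ a = 2 ^ a :=
  (Nat.even_iff.2 h).neg_pow 2

lemma neg_two_pow_odd {a : ℕ} (h : a % 2 = 1) : (-2 : ℝ) ^ a = -2 ^ a :=
  (Nat.odd_iff.2 h).neg_pow 2

lemma lt_of_two_pow_lt {a b : ℕ} (h : (2 : ℝ) ^ a < 2 ^ b) : a < b :=
  (pow_lt_pow_iff_right₀ (by norm_num)).1 h

lemma one_le_two_pow' (a : ℕ) : (1 : ℝ) ≤ 2 ^ a := one_le_pow₀ (by norm_num)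

/-- Powers of `-2` strictly between `0` and `(-2) ^ j`. -/
lemma pow_between_zero {a j : ℕ} {r : ℝ} (h0 : 0 < r) (h1 : r < 1)
    (h : (-2 : ℝ) ^ a = r * (-2) ^ j) : a < j ∧ a % 2 = j % 2 := by
  have ha := one_le_two_pow' a
  have hj := one_le_two_pow' j
  rcases Nat.mod_two_eq_zero_or_one a with pa | pa <;>
    rcases Nat.mod_two_eq_zero_or_one j with pj | pj <;>
    simp only [pa, pj, neg_two_pow_even, neg_two_pow_odd] at h
  · exact ⟨lt_of_two_pow_lt (by nlinarith), by omega⟩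
  · nlinarith
  · nlinarith
  · exact ⟨lt_of_two_pow_lt (by nlinarith), by omega⟩

/-- Powers of `-2` strictly between `1` and `(-2) ^ j`. -/
lemma pow_between_one {a j : ℕ} {r : ℝ} (h0 : 0 < r) (h1 : r < 1) (hj0 : j ≠ 0)
    (h : (-2 : ℝ) ^ a = 1 - r + r * (-2) ^ j) : a ≠ 0 ∧ a < j ∧ a % 2 = j % 2 := by
  have ha := one_le_two_pow' a
  have hj : (2 : ℝ) ≤ 2 ^ j := by
    simpa using pow_le_pow_right₀ (by norm_num : (1 : ℝ) ≤ 2) (Nat.one_le_iff_ne_zero.2 hj0)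
  have a0 : a ≠ 0 := by
    rintro rfl
    rcases Nat.mod_two_eq_zero_or_one j with pj | pj <;>
      simp only [pj, neg_two_pow_even, neg_two_pow_odd, pow_zero] at h <;> nlinarith
  refine ⟨a0, ?_⟩
  rcases Nat.mod_two_eq_zero_or_one a with pa | pa <;>
    rcases Nat.mod_two_eq_zero_or_one j with pj | pj <;>
    simp only [pa, pj, neg_two_pow_even, neg_two_pow_odd] at h
  · exact ⟨lt_of_two_pow_lt (by nlinarith), by omega⟩
  · nlinarith
  · nlinarith
  · exact ⟨lt_of_two_pow_lt (by nlinarith), by omega⟩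

lemma height_inl {m : ℕ} (z : Fin 1) : height (Sum.inl z : Fin 1 ⊕ Fin m) = 1 := by
  simp [height, level]

lemma height_injective {m : ℕ} : Function.Injective (height (m := m)) := by
  intro s t h
  apply level_injective
  have h2 := congrArg abs h
  simp only [height, abs_pow, abs_neg, Nat.abs_ofNat] at h2
  exact pow_right_injective₀ (by norm_num) (by norm_num) h2

lemma height_ne_zero {m : ℕ} (s : Fin 1 ⊕ Fin m) : height s ≠ 0 :=
  pow_ne_zero _ (by norm_num)

lemma height_inr {m : ℕ} (k : Fin m) :
    height (Sum.inr k : Fin 1 ⊕ Fin m) ≤ -2 ∨ 4 ≤ height (Sum.inr k : Fin 1 ⊕ Fin m) := by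
  simp only [height, level]
  rcases Nat.even_or_odd' (k : ℕ) with ⟨c, hc | hc⟩
  · left
    rw [neg_two_pow_odd (by omega), hc]
    have := one_le_two_pow' (2 * c)
    rw [pow_succ]; linarith
  · right
    rw [neg_two_pow_even (by omega), hc]
    have := one_le_two_pow' (2 * c)
    rw [pow_succ, pow_succ]; linarith

/-- No cycle lies at a height strictly between the two ends of a pendant edge of a leaf copy,
nor at its upper end. -/
lemma height_ne_mul_height {m : ℕ} (s : Fin 1 ⊕ Fin m) (k : Fin m) {r : ℝ} (h0 : 1 / 2 ≤ r)
    (h1 : r < 1) : height s ≠ r * height (Sum.inr k) := by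
  intro h
  obtain ⟨h2, h3⟩ := pow_between_zero (by linarith) h1 h
  have h4 : |height s| = r * |height (Sum.inr k : Fin 1 ⊕ Fin m)| := by
    rw [h, abs_mul, abs_of_pos (by linarith : 0 < r)]
  -- Equal parity puts the levels at least two apart, so the heights differ by a factor of at least
  -- 4, while `r` allows at most 2.
  obtain ⟨d, hd⟩ : ∃ d, level (Sum.inr k : Fin 1 ⊕ Fin m) = level s + 2 + d :=
    ⟨level (Sum.inr k : Fin 1 ⊕ Fin m) - (level s + 2), by omega⟩
  simp only [height, abs_pow, abs_neg, Nat.abs_ofNat] at h4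
  rw [hd, pow_add, pow_add] at h4
  have := one_le_two_pow' (level s)
  have := one_le_two_pow' d
  nlinarith [mul_le_mul_of_nonneg_left ‹(1 : ℝ) ≤ 2 ^ d› (by linarith : (0 : ℝ) ≤ 2 ^ level s)]

/-! ### Positions and paths -/

/-- The vertices of the product of a sunlet graph and a star. -/
abbrev Vertex (n m : ℕ) := (Fin n ⊕ Fin n) × (Fin 1 ⊕ Fin m)

/-- Representatives of the vertex positions in the covering plane. -/
noncomputable def vertexLift {n m : ℕ} : Vertex n m → ℝ × ℝ
  | (Sum.inl i, s) => ((i : ℝ) + offset s, height s)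
  | (Sum.inr i, Sum.inl _) => ((i : ℝ) + 1 / 4, 0)
  | (Sum.inr i, Sum.inr k) => ((i : ℝ) + 1 / 8, 1 / 2 * height (Sum.inr k : Fin 1 ⊕ Fin m))

/-- The positions of the vertices in the plane. -/
noncomputable def vertexPos {n m : ℕ} (v : Vertex n m) : ℝ × ℝ := cyl n (vertexLift v)

/-- The edges of the product, sorted by kind. -/
inductive Edge (n m : ℕ)
  /-- a cycle edge in one copy of the sunlet graph -/
  | row (i : Fin n) (s : Fin 1 ⊕ Fin m)
  /-- a star edge at a cycle vertex -/
  | spoke (i : Fin n) (k : Fin m)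
  /-- a pendant edge of the central copy -/
  | centralPendant (i : Fin n)
  /-- a pendant edge of another copy -/
  | leafPendant (i : Fin n) (k : Fin m)
  /-- a star edge at a pendant vertex -/
  | hub (i : Fin n) (k : Fin m)

/-- The segment in the covering plane that represents an edge. -/
noncomputable def Edge.path {n m : ℕ} : Edge n m → ℝ → ℝ × ℝ
  | .row i s, t => ((i : ℝ) + (offset s + t), height s)
  | .spoke i k, t => ((i : ℝ) + (t - 1) / 4, 1 - t + t * height (Sum.inr k : Fin 1 ⊕ Fin m))
  | .centralPendant i, t => ((i : ℝ) + (t / 2 - 1 / 4), 1 - t)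
  | .leafPendant i k, t =>
    ((i : ℝ) + t / 8, (1 - t / 2) * height (Sum.inr k : Fin 1 ⊕ Fin m))
  | .hub i k, t =>
    ((i : ℝ) + (1 + t) / 8, (1 - t) / 2 * height (Sum.inr k : Fin 1 ⊕ Fin m))

lemma Edge.continuous_path {n m : ℕ} (c : Edge n m) : Continuous c.path := by
  cases c <;> unfold Edge.path <;> fun_prop

lemma vertexPos_injective {n m : ℕ} : Function.Injective (vertexPos (n := n) (m := m)) := by
  rintro ⟨i | i, z | k⟩ ⟨j | j, z' | k'⟩ h
  all_goals
    have hn : n ≠ 0 := by rintro rfl; exact i.elim0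
    obtain ⟨hy, q, hx⟩ := (cyl_eq_iff hn).1 h
    simp only [vertexLift, offset] at hx hy
    obtain ⟨rfl, hu⟩ := column_unique hx (by norm_num) (by norm_num)
  -- The four kinds of vertices have distinct horizontal offsets -1/4, 0, 1/4, 1/8; within a kind,
  -- height separates the copies.
  all_goals first
    | (exfalso; norm_num at hu; done)
    | rw [Subsingleton.elim z z']
    | rw [Sum.inr_injective (height_injective hy)]
    | rw [Sum.inr_injective (height_injective (mul_left_cancel₀ (by norm_num) hy))]

lemma Edge.path_injOn {n m : ℕ} (hn : 3 ≤ n) (c : Edge n m) {t u : ℝ} (ht : t ∈ Set.Icc 0 1)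
    (hu : u ∈ Set.Icc 0 1) (h : cyl n (c.path t) = cyl n (c.path u)) : t = u := by
  obtain ⟨ht0, ht1⟩ := ht
  obtain ⟨hu0, hu1⟩ := hu
  obtain ⟨-, q, hx⟩ := (cyl_eq_iff (by omega)).1 h
  have hn' : (3 : ℝ) ≤ n := by exact_mod_cast hn
  -- The first coordinate of a path is strictly increasing and grows by at most 1, so it cannot wrap
  -- around.
  suffices hq : q = 0 by
    subst hq
    cases c <;> simp only [path, Int.cast_zero, zero_mul] at hx <;> linarith
  have h1 : -3 < (q : ℝ) * n ∧ (q : ℝ) * n < 3 := by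
    cases c <;> simp only [path] at hx <;> constructor <;> linarith
  by_contra hq
  rcases lt_or_gt_of_ne hq with hq | hq
  · have : (q : ℝ) ≤ -1 := by exact_mod_cast (by omega : q ≤ -1)
    nlinarith
  · have : (1 : ℝ) ≤ q := by exact_mod_cast (by omega : 1 ≤ q)
    nlinarith

lemma Edge.path_ne_vertexPos {n m : ℕ} (c : Edge n m) {t : ℝ} (ht : t ∈ Set.Ioo 0 1)
    (v : Vertex n m) : cyl n (c.path t) ≠ vertexPos v := by
  intro h
  obtain ⟨ht0, ht1⟩ := ht
  have hn : n ≠ 0 := by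
    rintro rfl
    obtain ⟨i | i, -⟩ := v <;> exact i.elim0
  obtain ⟨hy, q, hx⟩ := (cyl_eq_iff hn).1 h
  cases c with
  | row i s =>
    obtain ⟨j | j, w⟩ := v
    · simp only [path, vertexLift] at hx hy
      obtain rfl := height_injective hy
      obtain ⟨-, hu⟩ := column_unique hx (by linarith) (by linarith)
      linarith
    · rcases w with z | k
      · exact height_ne_zero s hy
      · exact height_ne_mul_height s k (by norm_num) (by norm_num) hy
  | spoke i k =>
    obtain ⟨j | j, z | k'⟩ := v <;> simp only [path, vertexLift, offset] at hx <;>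
      linarith [(column_unique hx (by linarith) (by linarith)).2]
  | leafPendant i k =>
    obtain ⟨j | j, z | k'⟩ := v <;> simp only [path, vertexLift, offset] at hx <;>
      linarith [(column_unique hx (by linarith) (by linarith)).2]
  | hub i k =>
    obtain ⟨j | j, z | k'⟩ := v <;> simp only [path, vertexLift, offset] at hx <;>
      linarith [(column_unique hx (by linarith) (by linarith)).2]
  | centralPendant i =>
    obtain ⟨j | j, z | k'⟩ := v <;> simp only [path, vertexLift, offset] at hx hy <;>
      have hu := (column_unique hx (by linarith) (by linarith)).2
    · linarith
    · rcases height_inr k' with hk | hk <;> linarith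
    · linarith
    · rcases height_inr k' with hk | hk <;> linarith

/-! ### Which edges meet -/

lemma Edge.row_eq_row {n m : ℕ} {i j : Fin n} {s s' : Fin 1 ⊕ Fin m} {t u : ℝ}
    (ht : t ∈ Set.Ioo 0 1) (hu : u ∈ Set.Ioo 0 1)
    (h : cyl n ((row i s).path t) = cyl n ((row j s').path u)) : row i s = row j s' := by
  obtain ⟨ht0, ht1⟩ := ht
  obtain ⟨hu0, hu1⟩ := hu
  obtain ⟨hy, q, hx⟩ := (cyl_eq_iff (by rintro rfl; exact i.elim0)).1 h
  simp only [path] at hx hy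
  obtain rfl := height_injective hy
  rw [(column_unique hx (by linarith) (by linarith)).1]

/-- The edge `c` crosses the cycle at level `a` in the cell with coordinates `i`, `k`, `r`. -/
def Edge.CrossesAt {n m : ℕ} (c : Edge n m) (a : ℕ) (i : Fin n) (k : Fin m) (r : ℕ) : Prop :=
  a % 2 = (k + 1) % 2 ∧ (c = spoke i k ∧ a = r + 1 ∨ c = hub i k ∧ a = r)

lemma Edge.exists_crossesAt {n m : ℕ} {i : Fin n} {s : Fin 1 ⊕ Fin m} {c : Edge n m} {t u : ℝ}
    (hc : c ≠ row i s) (ht : t ∈ Set.Ioo 0 1) (hu : u ∈ Set.Ioo 0 1)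
    (h : cyl n ((row i s).path t) = cyl n (c.path u)) :
    ∃ (j : Fin n) (k : Fin m) (r : Fin k), c.CrossesAt (level s) j k r := by
  cases c with
  | row j s' => exact absurd (row_eq_row ht hu h).symm hc
  | spoke j k =>
    obtain ⟨hu0, hu1⟩ := hu
    obtain ⟨hy, -⟩ := (cyl_eq_iff (by rintro rfl; exact i.elim0)).1 h
    obtain ⟨h1, h2, h3⟩ := pow_between_one hu0 hu1 (Nat.succ_ne_zero k) hy
    exact ⟨j, k, ⟨level s - 1, by omega⟩, h3, Or.inl ⟨rfl, by simp only; omega⟩⟩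
  | centralPendant j =>
    obtain ⟨hu0, hu1⟩ := hu
    obtain ⟨hy, -⟩ := (cyl_eq_iff (by rintro rfl; exact i.elim0)).1 h
    simp only [path] at hy
    rcases s with z | k
    · rw [height_inl] at hy; linarith
    · rcases height_inr k with hk | hk <;> linarith
  | leafPendant j k =>
    obtain ⟨hu0, hu1⟩ := hu
    obtain ⟨hy, -⟩ := (cyl_eq_iff (by rintro rfl; exact i.elim0)).1 h
    exact absurd hy (height_ne_mul_height s k (by linarith) (by linarith))
  | hub j k =>
    obtain ⟨hu0, hu1⟩ := hu
    obtain ⟨hy, -⟩ := (cyl_eq_iff (by rintro rfl; exact i.elim0)).1 h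
    obtain ⟨h1, h2⟩ := pow_between_zero (by linarith) (by linarith) hy
    have h3 : level (Sum.inr k : Fin 1 ⊕ Fin m) = k + 1 := rfl
    -- Being below `k + 1` with the same parity gives `level s < k`.
    exact ⟨j, k, ⟨level s, by omega⟩, h2, Or.inr ⟨rfl, rfl⟩⟩

/-- Edges within one column are drawn without crossings. -/
lemma Edge.eq_of_column {n m : ℕ} {c d : Edge n m} {t u : ℝ}
    (hc : ∀ i s, c ≠ row i s) (hd : ∀ i s, d ≠ row i s)
    (ht : t ∈ Set.Ioo 0 1) (hu : u ∈ Set.Ioo 0 1)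
    (h : cyl n (c.path t) = cyl n (d.path u)) : c = d := by
  obtain ⟨ht0, ht1⟩ := ht
  obtain ⟨hu0, hu1⟩ := hu
  have hn : n ≠ 0 := by
    rintro rfl
    cases c <;> exact Fin.elim0 ‹_›
  obtain ⟨hy, q, hx⟩ := (cyl_eq_iff hn).1 h
  -- The central pendant passes height 1/2 at offset 0, where the leaf cycle vertices sit. Spokes
  -- share its upper end, and each leaf pendant with its hub edge forms one segment to its lower
  -- end, so a meeting would force a leaf height of 1/2.
  have key : ∀ (a : ℝ) (k : Fin m), a ≠ 0 →
      a * height (Sum.inr k : Fin 1 ⊕ Fin m) ≠ a / 2 := by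
    intro a k ha hk
    have : height (Sum.inr k : Fin 1 ⊕ Fin m) = 1 / 2 := by
      apply mul_left_cancel₀ ha; linarith
    rcases height_inr k with hk | hk <;> linarith
  cases c <;> cases d <;> simp only [path] at hx hy
  case row.row => exact absurd rfl (hc _ _)
  case row.spoke => exact absurd rfl (hc _ _)
  case row.centralPendant => exact absurd rfl (hc _ _)
  case row.leafPendant => exact absurd rfl (hc _ _)
  case row.hub => exact absurd rfl (hc _ _)
  case spoke.row => exact absurd rfl (hd _ _)
  case centralPendant.row => exact absurd rfl (hd _ _)
  case leafPendant.row => exact absurd rfl (hd _ _)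
  case hub.row => exact absurd rfl (hd _ _)
  all_goals obtain ⟨rfl, hxx⟩ := column_unique hx (by linarith) (by linarith)
  case centralPendant.centralPendant => rfl
  case spoke.spoke i k j =>
    obtain rfl : t = u := by linarith
    rw [Sum.inr_injective (height_injective
      (mul_left_cancel₀ ht0.ne' (by linarith : t * height (Sum.inr k) = t * height (Sum.inr j))))]
  case leafPendant.leafPendant i k j =>
    obtain rfl : t = u := by linarith
    rw [Sum.inr_injective (height_injective
      (mul_left_cancel₀ (by linarith : 1 - t / 2 ≠ 0) hy))]
  case hub.hub i k j =>
    obtain rfl : t = u := by linarith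
    rw [Sum.inr_injective (height_injective
      (mul_left_cancel₀ (by linarith : (1 - t) / 2 ≠ 0) hy))]
  all_goals exfalso
  case spoke.centralPendant i k =>
    obtain rfl : u = t / 2 := by linarith
    exact key t k ht0.ne' (by linarith)
  case centralPendant.spoke i k =>
    obtain rfl : t = u / 2 := by linarith
    exact key u k hu0.ne' (by linarith)
  case centralPendant.leafPendant i k =>
    obtain rfl : t = 1 / 2 + u / 4 := by linarith
    exact key (1 - u / 2) k (by linarith) (by linarith)
  case leafPendant.centralPendant i k =>
    obtain rfl : u = 1 / 2 + t / 4 := by linarith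
    exact key (1 - t / 2) k (by linarith) (by linarith)
  case centralPendant.hub i k =>
    obtain rfl : t = 3 / 4 + u / 4 := by linarith
    exact key ((1 - u) / 2) k (by linarith) (by linarith)
  case hub.centralPendant i k =>
    obtain rfl : u = 3 / 4 + t / 4 := by linarith
    exact key ((1 - t) / 2) k (by linarith) (by linarith)
  all_goals linarith

/-! ### Matching graph edges with paths -/

/-- The edge `c` joins the points of the two ends of `e`. -/
def Edge.Represents {n m : ℕ} (c : Edge n m) (e : Sym2 (Vertex n m)) : Prop :=
  s(cyl n (c.path 0), cyl n (c.path 1)) = Sym2.map vertexPos e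

lemma Edge.Represents.unique {n m : ℕ} {c : Edge n m} {e f : Sym2 (Vertex n m)}
    (he : c.Represents e) (hf : c.Represents f) : e = f :=
  Sym2.map.injective vertexPos_injective (he.symm.trans hf)

lemma Edge.represents_row {n m : ℕ} {i j : Fin n} (hij : (j - i).val = 1)
    (s : Fin 1 ⊕ Fin m) :
    (row i s).Represents s((Sum.inl i, s), (Sum.inl j, s)) := by
  have hn : n ≠ 0 := by rintro rfl; exact i.elim0
  have h0 : cyl n ((row i s).path 0) = vertexPos (Sum.inl i, s) := by
    simp [path, vertexPos, vertexLift]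
  have h1 : cyl n ((row i s).path 1) = vertexPos (Sum.inl j, s) := by
    refine (cyl_eq_iff hn).2 ⟨rfl, ?_⟩
    simp only [path, vertexLift]
    -- `k = 1` is the edge that closes the cycle.
    have hk : ∃ k : ℤ, (i : ℤ) + 1 = j + k * n := by
      rcases le_or_gt i j with hle | hlt
      · refine ⟨0, ?_⟩
        rw [Fin.sub_val_of_le hle] at hij
        have : (i : ℕ) ≤ j := hle
        omega
      · refine ⟨1, ?_⟩
        rw [Fin.coe_sub_iff_lt.2 hlt] at hij
        omega
    obtain ⟨k, hk⟩ := hk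
    have hk' : (i : ℝ) + 1 = j + k * n := by exact_mod_cast hk
    exact ⟨k, by linarith⟩
  rw [Represents, h0, h1, Sym2.map_mk]

lemma Edge.represents_spoke {n m : ℕ} (i : Fin n) (z : Fin 1) (k : Fin m) :
    (spoke i k).Represents s((Sum.inl i, Sum.inl z), (Sum.inl i, Sum.inr k)) := by
  simp only [Represents, Sym2.map_mk, path, vertexPos, vertexLift, offset, height_inl]
  norm_num

lemma Edge.represents_centralPendant {n m : ℕ} (i : Fin n) (z : Fin 1) :
    (centralPendant i : Edge n m).Represents s((Sum.inl i, Sum.inl z), (Sum.inr i, Sum.inl z)) := by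
  simp only [Represents, Sym2.map_mk, path, vertexPos, vertexLift, offset, height_inl]
  norm_num

lemma Edge.represents_leafPendant {n m : ℕ} (i : Fin n) (k : Fin m) :
    (leafPendant i k).Represents s((Sum.inl i, Sum.inr k), (Sum.inr i, Sum.inr k)) := by
  simp only [Represents, Sym2.map_mk, path, vertexPos, vertexLift, offset]
  norm_num

lemma Edge.represents_hub {n m : ℕ} (i : Fin n) (z : Fin 1) (k : Fin m) :
    (hub i k).Represents s((Sum.inr i, Sum.inr k), (Sum.inr i, Sum.inl z)) := by
  simp only [Represents, Sym2.map_mk, path, vertexPos, vertexLift]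
  norm_num

lemma Edge.exists_represents {n m : ℕ} {e : Sym2 (Vertex n m)}
    (he : e ∈ ((sunletGraph n).boxProd (starK m)).edgeSet) : ∃ c : Edge n m, c.Represents e := by
  induction e using Sym2.ind with
  | _ v w =>
  obtain ⟨a, s⟩ := v
  obtain ⟨b, s'⟩ := w
  rw [SimpleGraph.mem_edgeSet, SimpleGraph.boxProd_adj] at he
  rcases he with ⟨h, rfl : s = s'⟩ | ⟨h, rfl : a = b⟩
  · rcases a with i | i <;> rcases b with j | j
    · rcases SimpleGraph.cycleGraph_adj'.1 h with h | h
      · rw [Sym2.eq_swap]; exact ⟨_, represents_row h s⟩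
      · exact ⟨_, represents_row h s⟩
    · obtain rfl : i = j := h
      rcases s with z | k
      · exact ⟨_, represents_centralPendant i z⟩
      · exact ⟨_, represents_leafPendant i k⟩
    · obtain rfl : i = j := h
      rw [Sym2.eq_swap]
      rcases s with z | k
      · exact ⟨_, represents_centralPendant i z⟩
      · exact ⟨_, represents_leafPendant i k⟩
    · exact h.elim
  · rcases s with z | k <;> rcases s' with z' | k' <;> simp at h
    · rcases a with i | i
      · exact ⟨_, represents_spoke i z k'⟩
      · rw [Sym2.eq_swap]; exact ⟨_, represents_hub i z k'⟩
    · rcases a with i | i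
      · rw [Sym2.eq_swap]; exact ⟨_, represents_spoke i z' k⟩
      · exact ⟨_, represents_hub i z' k⟩

/-- The kind of an edge of the product. -/
noncomputable def code {n m : ℕ} (e : ((sunletGraph n).boxProd (starK m)).edgeSet) : Edge n m :=
  (Edge.exists_represents e.2).choose

lemma code_represents {n m : ℕ} (e : ((sunletGraph n).boxProd (starK m)).edgeSet) :
    (code e).Represents e.1 :=
  (Edge.exists_represents e.2).choose_spec

lemma code_injective {n m : ℕ} : Function.Injective (code (n := n) (m := m)) := by
  intro e f h
  have hf := code_represents f
  rw [← h] at hf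
  exact Subtype.ext ((code_represents e).unique hf)

/-! ### The drawing and its crossings -/

/-- The drawing of the product of a sunlet graph and a star on concentric circles. -/
noncomputable def drawing {n : ℕ} (m : ℕ) (hn : 3 ≤ n) :
    PlaneDrawing ((sunletGraph n).boxProd (starK m)) where
  pos := vertexPos
  arc e t := cyl n ((code e).path t)
  pos_injective := vertexPos_injective
  arc_continuous e :=
    (continuous_cyl n).comp ((code e).continuous_path.comp continuous_subtype_val)
  arc_injective e t u h := Subtype.ext ((code e).path_injOn hn t.2 u.2 h)
  arc_ends e := code_represents e
  arc_avoids e _ ht v := (code e).path_ne_vertexPos ⟨ht.1, ht.2⟩ v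

lemma exists_of_mem_openArc {n m : ℕ} {hn : 3 ≤ n}
    {e : ((sunletGraph n).boxProd (starK m)).edgeSet} {p : ℝ × ℝ}
    (hp : p ∈ (drawing m hn).openArc e) :
    ∃ t ∈ Set.Ioo (0 : ℝ) 1, p = cyl n ((code e).path t) := by
  obtain ⟨t, ht, rfl⟩ := hp
  exact ⟨t, ⟨ht.1, ht.2⟩, rfl⟩

/-- The cells that index the crossings of the drawing. -/
abbrev Cell (n m : ℕ) := Fin n × (Σ k : Fin m, Fin k)

lemma card_cell (n m : ℕ) : Fintype.card (Cell n m) = n * (m * (m - 1) / 2) := by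
  simp only [Fintype.card_prod, Fintype.card_sigma, Fintype.card_fin]
  rw [Fin.sum_univ_eq_sum_range (fun k => k), Finset.sum_range_id]

/-- The crossing `x` lies in the cell `q`. -/
def InCell {n m : ℕ} (x : Sym2 ((sunletGraph n).boxProd (starK m)).edgeSet × (ℝ × ℝ))
    (q : Cell n m) : Prop :=
  ∃ e f j s, ∃ t ∈ Set.Ioo (0 : ℝ) 1, ∃ u ∈ Set.Ioo (0 : ℝ) 1, x.1 = s(e, f) ∧
    code e = .row j s ∧ x.2 = cyl n ((code e).path t) ∧ x.2 = cyl n ((code f).path u) ∧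
    (code f).CrossesAt (level s) q.1 q.2.1 q.2.2

lemma exists_inCell {n m : ℕ} {hn : 3 ≤ n}
    {x : Sym2 ((sunletGraph n).boxProd (starK m)).edgeSet × (ℝ × ℝ)}
    (hx : x ∈ (drawing m hn).crossingSet) : ∃ q, InCell x q := by
  obtain ⟨e, f, hef, h1, he, hf⟩ := hx
  obtain ⟨t, ht, het⟩ := exists_of_mem_openArc he
  obtain ⟨u, hu, hfu⟩ := exists_of_mem_openArc hf
  have aux : ∀ {e f : ((sunletGraph n).boxProd (starK m)).edgeSet} {t u : ℝ} {j s}, e ≠ f →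
      x.1 = s(e, f) → t ∈ Set.Ioo (0 : ℝ) 1 → u ∈ Set.Ioo (0 : ℝ) 1 →
      x.2 = cyl n ((code e).path t) → x.2 = cyl n ((code f).path u) →
      code e = .row j s → ∃ q, InCell x q := by
    intro e f t u j s hef h1 ht hu het hfu hrow
    obtain ⟨i, k, r, h⟩ := Edge.exists_crossesAt
      (fun h => hef (code_injective (hrow.trans h.symm))) ht hu (hrow ▸ het.symm.trans hfu)
    exact ⟨(i, ⟨k, r⟩), e, f, j, s, t, ht, u, hu, h1, hrow, het, hfu, h⟩
  by_cases hre : ∃ j s, code e = .row j s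
  · obtain ⟨j, s, hre⟩ := hre
    exact aux hef h1 ht hu het hfu hre
  by_cases hrf : ∃ j s, code f = .row j s
  · obtain ⟨j, s, hrf⟩ := hrf
    exact aux hef.symm (h1.trans Sym2.eq_swap) hu ht hfu het hrf
  push Not at hre hrf
  exact absurd (code_injective (Edge.eq_of_column hre hrf ht hu (het.symm.trans hfu))) hef

/-- Parity decides between the two alternatives: `r + 1` and `r` cannot both be congruent to `k + 1`
mod 2. -/
lemma Edge.CrossesAt.unique {n m : ℕ} {c d : Edge n m} {a b : ℕ} {i : Fin n} {k : Fin m} {r : ℕ}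
    (hc : c.CrossesAt a i k r) (hd : d.CrossesAt b i k r) : c = d ∧ a = b := by
  obtain ⟨hp, ⟨rfl, ha⟩ | ⟨rfl, ha⟩⟩ := hc <;> obtain ⟨hp', ⟨rfl, hb⟩ | ⟨rfl, hb⟩⟩ := hd <;>
    first
    | exact ⟨rfl, by omega⟩
    | omega

/-- An edge crosses the cycle of each level at most once. -/
lemma Edge.CrossesAt.param_unique {n m : ℕ} {c : Edge n m} {a : ℕ} {i : Fin n} {k : Fin m}
    {r : ℕ} (hc : c.CrossesAt a i k r) {t u : ℝ} (h : (c.path t).2 = (c.path u).2) : t = u := by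
  obtain ⟨-, ⟨rfl, -⟩ | ⟨rfl, -⟩⟩ := hc <;> simp only [path] at h
  · refine mul_right_cancel₀
      (b := height (Sum.inr k : Fin 1 ⊕ Fin m) - 1) ?_ (by linarith)
    rcases height_inr k with hk | hk <;> linarith
  · have := mul_right_cancel₀ (height_ne_zero _) h
    linarith

lemma InCell.unique {n m : ℕ}
    {x y : Sym2 ((sunletGraph n).boxProd (starK m)).edgeSet × (ℝ × ℝ)} {q : Cell n m}
    (hx : InCell x q) (hy : InCell y q) : x = y := by
  obtain ⟨e, f, j, s, t, ht, u, -, hx1, hrow, hxe, hxf, hcr⟩ := hx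
  obtain ⟨e', f', j', s', t', ht', u', -, hy1, hrow', hye, hyf, hcr'⟩ := hy
  have hn : n ≠ 0 := by rintro rfl; exact j.elim0
  obtain ⟨hff, hs⟩ := hcr.unique hcr'
  obtain rfl := code_injective hff
  obtain rfl := level_injective hs
  rw [hrow] at hxe
  rw [hrow'] at hye
  have h1 := ((cyl_eq_iff hn).1 (hxe.symm.trans hxf)).1
  have h2 := ((cyl_eq_iff hn).1 (hye.symm.trans hyf)).1
  obtain rfl : u = u' := hcr.param_unique (h1.symm.trans h2)
  have hp : x.2 = y.2 := hxf.trans hyf.symm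
  -- Open cycle edges are pairwise disjoint, so the common point determines the cycle edge.
  have hee : e = e' := code_injective <| by
    rw [hrow, hrow']
    exact Edge.row_eq_row ht ht' (hxe.symm.trans (hp.trans hye))
  exact Prod.ext (by rw [hx1, hy1, hee]) hp

lemma crossings_drawing_le {n m : ℕ} (hn : 3 ≤ n) :
    (drawing m hn).crossings ≤ ((n * (m * (m - 1) / 2) : ℕ) : ℕ∞) := by
  have h : ∀ x : (drawing m hn).crossingSet, ∃ q, InCell x.1 q := fun x => exists_inCell x.2
  choose g hg using h
  have hinj : Function.Injective g := fun x y hxy =>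
    Subtype.ext ((hg x).unique (hxy ▸ hg y))
  calc (drawing m hn).crossings ≤ ENat.card (Cell n m) :=
        ENat.card_le_card_of_injective hinj
    _ = _ := by rw [ENat.card_eq_coe_fintype_card, card_cell]

end SunletStar

theorem mainTheorem1 (n m : ℕ) (hn : 3 ≤ n) (hm : 1 ≤ m) :
    crossingNumber ((sunletGraph n).boxProd (starK m)) ≤ ((n * (m * (m - 1) / 2) : ℕ) : ℕ∞) :=
  (iInf_le _ (SunletStar.drawing m hn)).trans (SunletStar.crossings_drawing_le hn)
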